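/- Let $A(\lambda)=\sum_{i=0}^{d_A}\lambda^iA_i$ with $A_i\in\mathbb C^{n\times n}$, $D(\lambda)=\sum_{i=0}^{d_D}\lambda^iD_i$ with $D_i\in\mathbb C^{m\times m}$, $B\in\mathbb C^{n\times m}$, $C\in\mathbb C^{m\times n}$, where $2\le d_D<d_A$, and consider the system matrix $\mathcal S(\lambda)=\begin{bmatrix}A(\lambda)&-B\\ C&D(\lambda)\end{bmatrix}$. **Fiedler matrices.** Let $M_0=\mathrm{diag}(I_{(d_A-1)n},-A_0)$ and, for $1\le i\le d_A-1$, $$M_i=\mathrm{diag}\Big(I_{(d_A-i-1)n},\begin{bmatrix}-A_i&I_n\\ I_n&0\end{bmatrix},I_{(i-1)n}\Big),$$ and let $N_0,\dots,N_{d_D-1}$ be defined in the same way from $D_0,\dots,D_{d_D-1}$, with $d_D,m$ in place of $d_A,n$. Put $$\mathbb M_0=\begin{bmatrix}M_0&(e_{d_A}e_{d_D}^T)\otimes B\\ -(e_{d_D}e_{d_A}^T)\otimes C&N_0\end{bmatrix},\qquad \mathbb M_i=\begin{bmatrix}M_i&0\\0&N_i\end{bmatrix}\ (1\le i\le d_D-1),\qquad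 \mathbb M_i=\begin{bmatrix}M_i&0\\0&I_{d_Dm}\end{bmatrix}\ (d_D\le i\le d_A-1).$$ For a bijection $\sigma:\{0,\dots,d_A-1\}\to\{1,\dots,d_A\}$ put $\mathbb M_\sigma=\mathbb M_{\sigma^{-1}(1)}\mathbb M_{\sigma^{-1}(2)}\cdots\mathbb M_{\sigma^{-1}(d_A)}$; this is the constant part of the Fiedler pencil $\lambda\mathbb M_{d_A}-\mathbb M_\sigma$ of $\mathcal S(\lambda)$, where $\mathbb M_{d_A}=\mathrm{diag}(A_{d_A},I_{(d_A-1)n},D_{d_D},I_{(d_D-1)m})$. For $0\le i\le d_A-2$, $\sigma$ has a consecution at $i$ if $\sigma(i)<\sigma(i+1)$, and an inversion at $i$ otherwise. **Algorithm.** Block matrices $\mathbb W_0,\dots,\mathbb W_{d_A-2}$ are defined recursively. Write $\mathbb W_{i}=\begin{bmatrix}P&Q\\ R&T\end{bmatrix}$, where $P$ consists of the blocks of size $n\times n$, $Q$ of those of size $n\times m$, $R$ of those of size $m\times n$ and $T$ of those of size $m\times m$; $X(r,:)$ and $X(:,c)$ denote block rows and block columns. Start with $$\mathbb W_0=\left[\begin{array}{cc|cc}-A_1&I_n&0&0\\-A_0&0&B&0\\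 \hline 0&0&-D_1&I_m\\-C&0&-D_0&0\end{array}\right]\quad\text{or}\quad \mathbb W_0=\left[\begin{array}{cc|cc}-A_1&-A_0&0&B\\ I_n&0&0&0\\ \hline 0&-C&-D_1&-D_0\\0&0&I_m&0\end{array}\right]$$ if $\sigma$ has a consecution, respectively an inversion, at $0$. Given $\mathbb W_{i-1}=\begin{bmatrix}P&Q\\R&T\end{bmatrix}$: * For $i=1,\dots,d_D-2$, if $\sigma$ has a consecution at $i$, $$\mathbb W_i=\left[\begin{array}{ccc|ccc}-A_{i+1}&I_n&0&0&0&0\\ P(:,1)&0&P(:,2{:}\mathrm{end})&Q(:,1)&0&Q(:,2{:}\mathrm{end})\\ \hline 0&0&0&-D_{i+1}&I_m&0\\ R(:,1)&0&R(:,2{:}\mathrm{end})&T(:,1)&0&T(:,2{:}\mathrm{end})\end{array}\right],$$ and if $\sigma$ has an inversion at $i$, $$\mathbb W_i=\left[\begin{array}{cc|cc}-A_{i+1}&P(1,:)&0&Q(1,:)\\ I_n&0&0&0\\ 0&P(2{:}\mathrm{end},:)&0&Q(2{:}\mathrm{end},:)\\ \hline 0&R(1,:)&-D_{i+1}&T(1,:)\\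 0&0&I_m&0\\ 0&R(2{:}\mathrm{end},:)&0&T(2{:}\mathrm{end},:)\end{array}\right].$$ * For $i=d_D-1,\dots,d_A-2$, if $\sigma$ has a consecution, respectively an inversion, at $i$, $$\mathbb W_i=\left[\begin{array}{ccc|c}-A_{i+1}&I_n&0&0\\ P(:,1)&0&P(:,2{:}\mathrm{end})&Q\\ \hline R(:,1)&0&R(:,2{:}\mathrm{end})&T\end{array}\right],\qquad \mathbb W_i=\left[\begin{array}{cc|c}-A_{i+1}&P(1,:)&Q(1,:)\\ I_n&0&0\\ 0&P(2{:}\mathrm{end},:)&Q(2{:}\mathrm{end},:)\\ \hline 0&R&T\end{array}\right].$$ **Theorem.** For every bijection $\sigma$: each $\mathbb W_i$ ($0\le i\le d_A-2$) has $i+2$ block rows and columns of size $n$ and $\min(i+2,d_D)$ block rows and columns of size $m$; for $1\le i\le d_A-2$ the matrix $\mathbb W_{i-1}$ is a block submatrix of $\mathbb W_i$ (obtained by selecting block rows and block columns in their order; in particular the blocks of $\mathbb W_{i-1}$ are blocks of $\mathbb W_i$); and $$\mathbb W_{d_A-2}=\mathbb M_\sigma .$$ -/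

import Mathlib

open scoped Kronecker

/-! ### Bijections, consecutions -/

/-- A bijection `σ : {0, …, d - 1} → {1, …, d}` has a consecution at `i` (for `0 ≤ i ≤ d - 2`)
if `σ i < σ (i + 1)`; otherwise, for such `i`, it has an inversion at `i`. -/
def HasConsecutionAt {d : ℕ} (σ : Fin d ≃ Set.Icc 1 d) (i : ℕ) : Prop :=
  ∃ h : i + 1 < d, (σ ⟨i, Nat.lt_of_succ_lt h⟩ : ℕ) < (σ ⟨i + 1, h⟩ : ℕ)

instance {d : ℕ} (σ : Fin d ≃ Set.Icc 1 d) (i : ℕ) : Decidable (HasConsecutionAt σ i) := by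
  unfold HasConsecutionAt; infer_instance

/-! ### Fiedler matrices of a matrix polynomial

`P 0, P 1, …, P d` are the `k × k` coefficients of a matrix polynomial; a `dk × dk` matrix is
indexed by `Fin d × Fin k` (block index, index inside the block). Block indices start at `0`. -/

/-- `M_0 = diag(I_{(d-1)k}, -P_0)`. -/
def fiedlerFirst {R : Type*} [CommRing R] {k : ℕ} (d : ℕ) (P : ℕ → Matrix (Fin k) (Fin k) R) :
    Matrix (Fin d × Fin k) (Fin d × Fin k) R :=
  Matrix.comp _ _ _ _ _ (Matrix.diagonal fun r : Fin d => if (r : ℕ) + 1 = d then -P 0 else 1)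

/-- `M_d = diag(P_d, I_{(d-1)k})`. -/
def fiedlerLast {R : Type*} [CommRing R] {k : ℕ} (d : ℕ) (P : ℕ → Matrix (Fin k) (Fin k) R) :
    Matrix (Fin d × Fin k) (Fin d × Fin k) R :=
  Matrix.comp _ _ _ _ _ (Matrix.diagonal fun r : Fin d => if (r : ℕ) = 0 then P d else 1)

/-- `M_i = diag(I_{(d-i-1)k}, [-P_i, I_k; I_k, 0], I_{(i-1)k})` for `1 ≤ i ≤ d - 1`; the middle
part occupies the block positions `d - i - 1` and `d - i` (counted from `0`). -/
def fiedlerMid {R : Type*} [CommRing R] {k : ℕ} (d : ℕ) (P : ℕ → Matrix (Fin k) (Fin k) R)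
    (i : ℕ) : Matrix (Fin d × Fin k) (Fin d × Fin k) R :=
  Matrix.comp _ _ _ _ _ (Matrix.of fun r c : Fin d =>
    if (r : ℕ) + i + 1 = d ∧ (c : ℕ) + i + 1 = d then -P i
    else if (r : ℕ) + i + 1 = d ∧ (c : ℕ) + i = d then 1
    else if (r : ℕ) + i = d ∧ (c : ℕ) + i + 1 = d then 1
    else if (r : ℕ) + i = d ∧ (c : ℕ) + i = d then 0
    else if r = c then 1
    else 0)

/-- The `j`-th standard unit column `e_j` of length `d`, for `1 ≤ j ≤ d`. -/
def unitColumn (R : Type*) [CommRing R] (d j : ℕ) : Fin d → R :=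
  fun r => if (r : ℕ) + 1 = j then 1 else 0

/-! ### Fiedler matrices of the system matrix -/

/-- Square matrices of size `p n + q m`, partitioned into `p` block rows and columns of size `n`
followed by `q` block rows and columns of size `m`. -/
abbrev SysMatrix (R : Type*) (n m p q : ℕ) : Type _ :=
  Matrix ((Fin p × Fin n) ⊕ (Fin q × Fin m)) ((Fin p × Fin n) ⊕ (Fin q × Fin m)) R

/-- The Fiedler matrices `𝕄_0, …, 𝕄_d`, `d = max dA dD`, of the system matrix
`S(λ) = [A(λ), -B; C, D(λ)]`, where `A i`, `D i` are the coefficients of `A(λ)`, `D(λ)`. -/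
def sysFiedler {R : Type*} [CommRing R] {n m : ℕ} (dA dD : ℕ)
    (A : ℕ → Matrix (Fin n) (Fin n) R) (B : Matrix (Fin n) (Fin m) R)
    (C : Matrix (Fin m) (Fin n) R) (D : ℕ → Matrix (Fin m) (Fin m) R) (i : ℕ) :
    SysMatrix R n m dA dD :=
  if i = 0 then
    Matrix.fromBlocks
      (fiedlerFirst dA A)
      (Matrix.vecMulVec (unitColumn R dA dA) (unitColumn R dD dD) ⊗ₖ B)
      (-(Matrix.vecMulVec (unitColumn R dD dD) (unitColumn R dA dA)) ⊗ₖ C)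
      (fiedlerFirst dD D)
  else if i = max dA dD then
    Matrix.fromBlocks (fiedlerLast dA A) 0 0 (fiedlerLast dD D)
  else
    Matrix.fromBlocks
      (if i < dA then fiedlerMid dA A i else 1) 0
      0 (if i < dD then fiedlerMid dD D i else 1)

/-- `𝕄_σ = 𝕄_{σ⁻¹(1)} 𝕄_{σ⁻¹(2)} ⋯ 𝕄_{σ⁻¹(d)}`. -/
def sysFiedlerProduct {R : Type*} [CommRing R] {n m : ℕ} (dA dD : ℕ)
    (A : ℕ → Matrix (Fin n) (Fin n) R) (B : Matrix (Fin n) (Fin m) R)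
    (C : Matrix (Fin m) (Fin n) R) (D : ℕ → Matrix (Fin m) (Fin m) R)
    {d : ℕ} (σ : Fin d ≃ Set.Icc 1 d) : SysMatrix R n m dA dD :=
  (List.ofFn fun j : Fin d =>
    sysFiedler dA dD A B C D (σ.symm ⟨(j : ℕ) + 1, Nat.succ_le_succ (Nat.zero_le _), j.isLt⟩)).prod

/-! ### The algorithm -/

/-- A block matrix whose numbers `p`, `q` of block rows (= block columns) of size `n`,
respectively `m`, are part of the data. -/
structure SysBlockMatrix (R : Type*) (n m : ℕ) where
  p : ℕ
  q : ℕ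
  mat : SysMatrix R n m p q

namespace SysBlockMatrix

/-- The block in block row `r` and block column `c` of the upper left part (counted from `0`;
zero outside the range). -/
def aa {R : Type*} [CommRing R] {n m : ℕ} (W : SysBlockMatrix R n m) (r c : ℕ) :
    Matrix (Fin n) (Fin n) R :=
  if h : r < W.p ∧ c < W.p then
    Matrix.of fun x y => W.mat (Sum.inl (⟨r, h.1⟩, x)) (Sum.inl (⟨c, h.2⟩, y))
  else 0

/-- The blocks of the upper right part. -/
def ad {R : Type*} [CommRing R] {n m : ℕ} (W : SysBlockMatrix R n m) (r c : ℕ) :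
    Matrix (Fin n) (Fin m) R :=
  if h : r < W.p ∧ c < W.q then
    Matrix.of fun x y => W.mat (Sum.inl (⟨r, h.1⟩, x)) (Sum.inr (⟨c, h.2⟩, y))
  else 0

/-- The blocks of the lower left part. -/
def da {R : Type*} [CommRing R] {n m : ℕ} (W : SysBlockMatrix R n m) (r c : ℕ) :
    Matrix (Fin m) (Fin n) R :=
  if h : r < W.q ∧ c < W.p then
    Matrix.of fun x y => W.mat (Sum.inr (⟨r, h.1⟩, x)) (Sum.inl (⟨c, h.2⟩, y))
  else 0

/-- The blocks of the lower right part. -/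
def dd {R : Type*} [CommRing R] {n m : ℕ} (W : SysBlockMatrix R n m) (r c : ℕ) :
    Matrix (Fin m) (Fin m) R :=
  if h : r < W.q ∧ c < W.q then
    Matrix.of fun x y => W.mat (Sum.inr (⟨r, h.1⟩, x)) (Sum.inr (⟨c, h.2⟩, y))
  else 0

/-- The block matrix `[AA, AD; DA, DD]` with the prescribed numbers of blocks and the prescribed
blocks (counted from `0` in each of the four parts). -/
def ofBlocks {R : Type*} {n m : ℕ} (p q : ℕ)
    (AA : ℕ → ℕ → Matrix (Fin n) (Fin n) R) (AD : ℕ → ℕ → Matrix (Fin n) (Fin m) R)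
    (DA : ℕ → ℕ → Matrix (Fin m) (Fin n) R) (DD : ℕ → ℕ → Matrix (Fin m) (Fin m) R) :
    SysBlockMatrix R n m where
  p := p
  q := q
  mat := Matrix.fromBlocks
    (Matrix.comp _ _ _ _ _ (Matrix.of fun r c : Fin p => AA r c))
    (Matrix.comp _ _ _ _ _ (Matrix.of fun (r : Fin p) (c : Fin q) => AD r c))
    (Matrix.comp _ _ _ _ _ (Matrix.of fun (r : Fin q) (c : Fin p) => DA r c))
    (Matrix.comp _ _ _ _ _ (Matrix.of fun r c : Fin q => DD r c))

/-- `X` is a block submatrix of `Y`: the blocks of `X` are the blocks of `Y` in selected block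
rows and block columns, taken in their order in `Y`. -/
def IsBlockSubmatrix {R : Type*} {n m : ℕ} (X Y : SysBlockMatrix R n m) : Prop :=
  ∃ (rowA colA : Fin X.p ↪o Fin Y.p) (rowD colD : Fin X.q ↪o Fin Y.q),
    X.mat = Y.mat.submatrix
      (Sum.map (Prod.map rowA id) (Prod.map rowD id))
      (Sum.map (Prod.map colA id) (Prod.map colD id))

end SysBlockMatrix

/-- The array `[x, y, 0; X(:,1), 0, X(:,2:end)]`. -/
def consecutionBorder {R : Type*} [CommRing R] {k l : ℕ} (x y : Matrix (Fin k) (Fin l) R)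
    (X : ℕ → ℕ → Matrix (Fin k) (Fin l) R) : ℕ → ℕ → Matrix (Fin k) (Fin l) R
  | 0, 0 => x
  | 0, 1 => y
  | 0, _ + 2 => 0
  | r + 1, 0 => X r 0
  | _ + 1, 1 => 0
  | r + 1, c + 2 => X r (c + 1)

/-- The array `[x, X(1,:); y, 0; 0, X(2:end,:)]`. -/
def inversionBorder {R : Type*} [CommRing R] {k l : ℕ} (x y : Matrix (Fin k) (Fin l) R)
    (X : ℕ → ℕ → Matrix (Fin k) (Fin l) R) : ℕ → ℕ → Matrix (Fin k) (Fin l) R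
  | 0, 0 => x
  | 0, c + 1 => X 0 c
  | 1, 0 => y
  | 1, _ + 1 => 0
  | _ + 2, 0 => 0
  | r + 2, c + 1 => X (r + 1) c

/-- The array `[0; X]`. -/
def zeroRowOnTop {R : Type*} [CommRing R] {k l : ℕ}
    (X : ℕ → ℕ → Matrix (Fin k) (Fin l) R) : ℕ → ℕ → Matrix (Fin k) (Fin l) R
  | 0, _ => 0
  | r + 1, c => X r c

/-- The array `[X(1,:); 0; X(2:end,:)]`. -/
def zeroRowSecond {R : Type*} [CommRing R] {k l : ℕ}
    (X : ℕ → ℕ → Matrix (Fin k) (Fin l) R) : ℕ → ℕ → Matrix (Fin k) (Fin l) R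
  | 0, c => X 0 c
  | 1, _ => 0
  | r + 2, c => X (r + 1) c

/-- The array `[0, X]`. -/
def zeroColumnOnLeft {R : Type*} [CommRing R] {k l : ℕ}
    (X : ℕ → ℕ → Matrix (Fin k) (Fin l) R) : ℕ → ℕ → Matrix (Fin k) (Fin l) R
  | _, 0 => 0
  | r, c + 1 => X r c

/-- The array `[X(:,1), 0, X(:,2:end)]`. -/
def zeroColumnSecond {R : Type*} [CommRing R] {k l : ℕ}
    (X : ℕ → ℕ → Matrix (Fin k) (Fin l) R) : ℕ → ℕ → Matrix (Fin k) (Fin l) R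
  | r, 0 => X r 0
  | _, 1 => 0
  | r, c + 2 => X r (c + 1)

/-- The initial matrix `𝕎_0`: it is
`[-A₁, I, 0, 0; -A₀, 0, B, 0; 0, 0, -D₁, I; -C, 0, -D₀, 0]` if `σ` has a consecution at `0`, and
`[-A₁, -A₀, 0, B; I, 0, 0, 0; 0, -C, -D₁, -D₀; 0, 0, I, 0]` otherwise. -/
def algorithmInit {R : Type*} [CommRing R] {n m d : ℕ}
    (A : ℕ → Matrix (Fin n) (Fin n) R) (B : Matrix (Fin n) (Fin m) R)
    (C : Matrix (Fin m) (Fin n) R) (D : ℕ → Matrix (Fin m) (Fin m) R)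
    (σ : Fin d ≃ Set.Icc 1 d) : SysBlockMatrix R n m :=
  if HasConsecutionAt σ 0 then
    ⟨2, 2, Matrix.fromBlocks
      (Matrix.comp _ _ _ _ _ !![-A 1, 1; -A 0, 0])
      (Matrix.comp _ _ _ _ _ !![0, 0; B, 0])
      (Matrix.comp _ _ _ _ _ !![0, 0; -C, 0])
      (Matrix.comp _ _ _ _ _ !![-D 1, 1; -D 0, 0])⟩
  else
    ⟨2, 2, Matrix.fromBlocks
      (Matrix.comp _ _ _ _ _ !![-A 1, -A 0; 1, 0])
      (Matrix.comp _ _ _ _ _ !![0, B; 0, 0])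
      (Matrix.comp _ _ _ _ _ !![0, -C; 0, 0])
      (Matrix.comp _ _ _ _ _ !![-D 1, -D 0; 1, 0])⟩

/-- The body of the first loop, for the loop index `i`: from `W = 𝕎_{i-1}` to `𝕎_i`. Both the
`A`-part and the `D`-part grow by one block row and one block column. -/
def algorithmFirstLoop {R : Type*} [CommRing R] {n m d : ℕ}
    (A : ℕ → Matrix (Fin n) (Fin n) R) (D : ℕ → Matrix (Fin m) (Fin m) R)
    (σ : Fin d ≃ Set.Icc 1 d) (i : ℕ) (W : SysBlockMatrix R n m) : SysBlockMatrix R n m :=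
  if HasConsecutionAt σ i then
    SysBlockMatrix.ofBlocks (W.p + 1) (W.q + 1)
      (consecutionBorder (-A (i + 1)) 1 W.aa)
      (consecutionBorder 0 0 W.ad)
      (consecutionBorder 0 0 W.da)
      (consecutionBorder (-D (i + 1)) 1 W.dd)
  else
    SysBlockMatrix.ofBlocks (W.p + 1) (W.q + 1)
      (inversionBorder (-A (i + 1)) 1 W.aa)
      (inversionBorder 0 0 W.ad)
      (inversionBorder 0 0 W.da)
      (inversionBorder (-D (i + 1)) 1 W.dd)

/-- The body of the second loop, for the loop index `i`: from `W = 𝕎_{i-1}` to `𝕎_i`. Only the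
`A`-part grows. -/
def algorithmSecondLoop {R : Type*} [CommRing R] {n m d : ℕ}
    (A : ℕ → Matrix (Fin n) (Fin n) R)
    (σ : Fin d ≃ Set.Icc 1 d) (i : ℕ) (W : SysBlockMatrix R n m) : SysBlockMatrix R n m :=
  if HasConsecutionAt σ i then
    SysBlockMatrix.ofBlocks (W.p + 1) W.q
      (consecutionBorder (-A (i + 1)) 1 W.aa)
      (zeroRowOnTop W.ad)
      (zeroColumnSecond W.da)
      W.dd
  else
    SysBlockMatrix.ofBlocks (W.p + 1) W.q
      (inversionBorder (-A (i + 1)) 1 W.aa)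
      (zeroRowSecond W.ad)
      (zeroColumnOnLeft W.da)
      W.dd

/-- The sequence `𝕎_0, 𝕎_1, …` produced by the algorithm: the first loop runs over
`i = 1, …, dD - 2`, the second one over `i = dD - 1, dD, …`. -/
def algorithmW {R : Type*} [CommRing R] {n m d : ℕ} (dD : ℕ)
    (A : ℕ → Matrix (Fin n) (Fin n) R) (B : Matrix (Fin n) (Fin m) R)
    (C : Matrix (Fin m) (Fin n) R) (D : ℕ → Matrix (Fin m) (Fin m) R)
    (σ : Fin d ≃ Set.Icc 1 d) : ℕ → SysBlockMatrix R n m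
  | 0 => algorithmInit A B C D σ
  | i + 1 =>
    if (i + 1) + 2 ≤ dD then
      algorithmFirstLoop A D σ (i + 1) (algorithmW dD A B C D σ i)
    else
      algorithmSecondLoop A σ (i + 1) (algorithmW dD A B C D σ i)

/-- The product of `f 0, …, f k` in which `f (i + 1)` is multiplied on the right if `c i` holds and
on the left otherwise. -/
def borderedProduct {M : Type*} [Monoid M] (f : ℕ → M) (c : ℕ → Prop) [DecidablePred c] : ℕ → M
  | 0 => f 0
  | k + 1 => if c k then borderedProduct f c k * f (k + 1) else f (k + 1) * borderedProduct f c k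

theorem List.commute_prod_map {M : Type*} [Monoid M] (f : ℕ → M) (a : M) (l : List ℕ)
    (h : ∀ x ∈ l, Commute (f x) a) : Commute (l.map f).prod a := by
  induction l with
  | nil => simp
  | cons x l ih =>
    simp only [List.map_cons, List.prod_cons]
    exact (h x (by simp)).mul_left (ih fun y hy => h y (by simp [hy]))

/-- If `f i` and `f j` commute for `|i - j| ≥ 2`, the product of `f 0, …, f k` in the order given
by `s` depends only on the relative order of neighbouring indices. -/
theorem List.prod_map_eq_borderedProduct {M : Type*} [Monoid M] (f : ℕ → M) (s : ℕ → ℕ)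
    (c : ℕ → Prop) [DecidablePred c] (k : ℕ)
    (hf : ∀ i j, i + 2 ≤ j → j ≤ k → Commute (f i) (f j))
    (hc : ∀ i, i < k → (c i ↔ s i < s (i + 1))) (l : List ℕ) (hl : ∀ x, x ∈ l ↔ x ≤ k)
    (hs : l.Pairwise fun a b => s a < s b) : (l.map f).prod = borderedProduct f c k := by
  induction k generalizing l with
  | zero =>
    match l with
    | [] => simpa using hl 0
    | [a] =>
      obtain rfl : a = 0 := by simpa using hl a
      simp [borderedProduct]
    | a :: b :: l =>
      have ha : a = 0 := by simpa using hl a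
      have hb : b = 0 := by simpa using hl b
      subst ha hb
      simp at hs
  | succ k ih =>
    obtain ⟨l₁, l₂, rfl⟩ := List.append_of_mem ((hl (k + 1)).2 le_rfl)
    rw [List.pairwise_append, List.pairwise_cons] at hs
    obtain ⟨hs₁, ⟨hk₂, hs₂⟩, h₁₂⟩ := hs
    have hk₁ : ∀ a ∈ l₁, s a < s (k + 1) := fun a ha => h₁₂ a ha _ (by simp)
    have hmem : ∀ x, x ∈ l₁ ++ l₂ ↔ x ≤ k := by
      intro x
      have hx := hl x
      simp only [List.mem_append, List.mem_cons] at hx ⊢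
      constructor
      · intro h
        have : x ≤ k + 1 := hx.1 (by tauto)
        have : x ≠ k + 1 := by
          rintro rfl
          rcases h with h | h
          · exact (hk₁ _ h).false
          · exact (hk₂ _ h).false
        omega
      · intro h
        have := hx.2 (by omega)
        have : x ≠ k + 1 := by omega
        tauto
    have hprod := ih (fun i j hij hj => hf i j hij (by omega)) (fun i hi => hc i (by omega))
      (l₁ ++ l₂) hmem
      (List.pairwise_append.2 ⟨hs₁, hs₂, fun a ha b hb => h₁₂ a ha b (by simp [hb])⟩)
    have hck := hc k (by omega)
    simp only [borderedProduct, ← hprod, List.map_append, List.map_cons, List.prod_append,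
      List.prod_cons]
    have hcomm : ∀ x ∈ l₁ ++ l₂, x ≠ k → Commute (f x) (f (k + 1)) := by
      intro x hx hxk
      have := (hmem x).1 hx
      exact hf x (k + 1) (by omega) le_rfl
    split_ifs with h
    · have hl₂ : Commute (l₂.map f).prod (f (k + 1)) := by
        refine List.commute_prod_map f _ _ fun x hx => hcomm x (by simp [hx]) ?_
        rintro rfl
        exact (hk₂ _ hx).asymm (hck.1 h)
      rw [← hl₂.eq, mul_assoc]
    · have hl₁ : Commute (l₁.map f).prod (f (k + 1)) := by
        refine List.commute_prod_map f _ _ fun x hx => hcomm x (by simp [hx]) ?_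
        rintro rfl
        exact h (hck.2 (hk₁ _ hx))
      rw [← mul_assoc, hl₁.eq, mul_assoc]

section Blocks

variable {R : Type*} [CommRing R] {k l n m : ℕ}

/-- The `a × b` block matrix with blocks `X r c`. -/
def blockArray (a b : ℕ) (X : ℕ → ℕ → Matrix (Fin k) (Fin l) R) :
    Matrix (Fin a × Fin k) (Fin b × Fin l) R :=
  Matrix.comp _ _ _ _ _ (Matrix.of fun (r : Fin a) (c : Fin b) => X r c)

/-- The array `[δ, δ; δ, X]`, where `X` begins in block row `s` and block column `t`. -/
def padArray (δ : ℕ → ℕ → Matrix (Fin k) (Fin l) R) (s t : ℕ)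
    (X : ℕ → ℕ → Matrix (Fin k) (Fin l) R) (r c : ℕ) : Matrix (Fin k) (Fin l) R :=
  if r < s ∨ c < t then δ r c else X (r - s) (c - t)

/-- The array of the blocks of an identity matrix. -/
def identityArray (r c : ℕ) : Matrix (Fin k) (Fin k) R := if r = c then 1 else 0

theorem blockArray_congr {a b : ℕ} {X Y : ℕ → ℕ → Matrix (Fin k) (Fin l) R}
    (h : ∀ r c, r < a → c < b → X r c = Y r c) : blockArray a b X = blockArray a b Y := by
  ext ⟨r, x⟩ ⟨c, y⟩
  simp [blockArray, h r c r.2 c.2]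

theorem blockArray_mul_fiedlerMid {a b i : ℕ} (X : ℕ → ℕ → Matrix (Fin k) (Fin l) R)
    (P : ℕ → Matrix (Fin l) (Fin l) R) (hi : 1 ≤ i) (hb : i < b) :
    blockArray a b X * fiedlerMid b P i = blockArray a b fun r c =>
      if c + i + 1 = b then X r (c + 1) - X r c * P i
      else if c + i = b then X r (c - 1) else X r c := by
  ext ⟨r, x⟩ ⟨c, y⟩
  rw [Matrix.mul_apply, Fintype.sum_prod_type]
  have key : ∀ j : Fin b, ∑ z, blockArray a b X (r, x) (j, z) * fiedlerMid b P i (j, z) (c, y) =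
      (X r j * (if (j : ℕ) + i + 1 = b ∧ (c : ℕ) + i + 1 = b then -P i
        else if (j : ℕ) + i + 1 = b ∧ (c : ℕ) + i = b then 1
        else if (j : ℕ) + i = b ∧ (c : ℕ) + i + 1 = b then 1
        else if (j : ℕ) + i = b ∧ (c : ℕ) + i = b then 0
        else if j = c then 1
        else 0)) x y := by
    intro j
    simp only [Matrix.mul_apply, blockArray, fiedlerMid, Matrix.comp_apply, Matrix.of_apply]
  rw [Finset.sum_congr rfl fun j _ => key j]
  simp only [blockArray, Matrix.comp_apply, Matrix.of_apply]
  split_ifs with h₁ h₂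
  · rw [Finset.sum_eq_add (⟨c + 1, by omega⟩ : Fin b) c]
    · have e : (c : ℕ) + 1 + i = b := by omega
      have e' : ¬ (c : ℕ) + 1 + i + 1 = b := by omega
      simp [h₁, e]
      ring
    · simp [Fin.ext_iff]
    · rintro j - ⟨hj₁, hj₂⟩
      simp only [ne_eq, Fin.ext_iff] at hj₁ hj₂
      have e₁ : ¬ (j : ℕ) + i + 1 = b := by omega
      have e₂ : ¬ (j : ℕ) + i = b := by omega
      simp [e₁, e₂, Fin.ext_iff, hj₂]
    · simp
    · simp
  · rw [Finset.sum_eq_single (⟨c - 1, by omega⟩ : Fin b)]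
    · have e : (c : ℕ) - 1 + i + 1 = b := by omega
      simp [h₂, e]
    · rintro j - hj
      simp only [ne_eq, Fin.ext_iff] at hj
      have e₁ : ¬ (j : ℕ) + i + 1 = b := by omega
      by_cases e₂ : (j : ℕ) + i = b
      · simp [h₂, e₂]
      · have e₃ : (j : ℕ) ≠ c := by omega
        simp [e₁, e₂, Fin.ext_iff, e₃]
    · simp
  · rw [Finset.sum_eq_single c]
    · simp [h₁, h₂]
    · rintro j - hj
      simp [h₁, h₂, hj]
    · simp

theorem blockArray_transpose {a b : ℕ} (X : ℕ → ℕ → Matrix (Fin k) (Fin l) R) :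
    (blockArray a b X).transpose = blockArray b a fun r c => (X c r).transpose := by
  ext ⟨r, x⟩ ⟨c, y⟩
  simp [blockArray]

theorem fiedlerMid_eq_blockArray (b : ℕ) (P : ℕ → Matrix (Fin k) (Fin k) R) (i : ℕ) :
    fiedlerMid b P i = blockArray b b fun r c =>
      if r + i + 1 = b ∧ c + i + 1 = b then -P i
      else if r + i + 1 = b ∧ c + i = b then 1
      else if r + i = b ∧ c + i + 1 = b then 1
      else if r + i = b ∧ c + i = b then 0
      else identityArray r c := by
  simp only [fiedlerMid, blockArray, identityArray, Fin.ext_iff]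

theorem fiedlerMid_transpose {b : ℕ} (P : ℕ → Matrix (Fin k) (Fin k) R) (i : ℕ) :
    (fiedlerMid b P i).transpose = fiedlerMid b (fun j => (P j).transpose) i := by
  rw [fiedlerMid_eq_blockArray, fiedlerMid_eq_blockArray, blockArray_transpose]
  refine blockArray_congr fun r c _ _ => ?_
  simp only [identityArray]
  split_ifs <;> first | (exfalso; omega) | simp

theorem fiedlerMid_mul_blockArray {a b i : ℕ} (X : ℕ → ℕ → Matrix (Fin k) (Fin l) R)
    (P : ℕ → Matrix (Fin k) (Fin k) R) (hi : 1 ≤ i) (ha : i < a) :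
    fiedlerMid a P i * blockArray a b X = blockArray a b fun r c =>
      if r + i + 1 = a then X (r + 1) c - P i * X r c
      else if r + i = a then X (r - 1) c else X r c := by
  apply Matrix.transpose_injective
  rw [Matrix.transpose_mul, fiedlerMid_transpose, blockArray_transpose,
    blockArray_mul_fiedlerMid _ _ hi ha, blockArray_transpose]
  refine blockArray_congr fun r c _ _ => ?_
  split_ifs <;> simp

/-- `diag(I, X)` commutes with `M_i` if `X` does not meet the block positions in which `M_i`
differs from the identity. -/
theorem blockArray_commute_fiedlerMid {b i : ℕ} {X : ℕ → ℕ → Matrix (Fin k) (Fin k) R}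
    (P : ℕ → Matrix (Fin k) (Fin k) R) (hi : 1 ≤ i) (hb : i < b)
    (hX : ∀ r c, r + i ≤ b ∨ c + i ≤ b → X r c = identityArray r c) :
    Commute (blockArray b b X) (fiedlerMid b P i) := by
  rw [Commute, SemiconjBy, blockArray_mul_fiedlerMid X P hi hb, fiedlerMid_mul_blockArray X P hi hb]
  refine blockArray_congr fun r c _ _ => ?_
  split_ifs <;> (repeat rw [hX _ _ (by omega)]) <;> simp only [identityArray] <;> split_ifs <;>
    first | (exfalso; omega) | simp

theorem fiedlerMid_commute_fiedlerMid {b i j : ℕ} (P : ℕ → Matrix (Fin k) (Fin k) R)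
    (hij : i + 2 ≤ j) (hb : j < b) :
    Commute (fiedlerMid b P i) (fiedlerMid b P j) := by
  rw [fiedlerMid_eq_blockArray b P i]
  refine blockArray_commute_fiedlerMid P (by omega) hb fun r c h => ?_
  rw [if_neg (by omega), if_neg (by omega), if_neg (by omega), if_neg (by omega)]

theorem zero_pad_mul_fiedlerMid {a b i s t : ℕ} (X : ℕ → ℕ → Matrix (Fin k) (Fin l) R)
    (P : ℕ → Matrix (Fin l) (Fin l) R) (hi : 1 ≤ i) (hb : t + 1 + i = b) :
    blockArray a b (padArray 0 s (t + 1) X) * fiedlerMid b P i =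
      blockArray a b (padArray 0 s t (zeroColumnSecond X)) := by
  rw [blockArray_mul_fiedlerMid _ _ hi (by omega)]
  refine blockArray_congr fun r c _ _ => ?_
  by_cases hr : r < s
  · simp [padArray, hr]
  obtain h | rfl | rfl | ⟨e, rfl⟩ : c < t ∨ c = t ∨ c = t + 1 ∨ ∃ e, c = t + e + 2 := by
    by_cases h : c < t + 2
    · omega
    · exact .inr (.inr (.inr ⟨c - t - 2, by omega⟩))
  · simp [padArray, hr, h, show ¬ c + i + 1 = b by omega, show ¬ c + i = b by omega,
      show c < t + 1 by omega]
  · simp [padArray, hr, show c + i + 1 = b by omega, zeroColumnSecond]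
  · simp [padArray, hr, hb, zeroColumnSecond]
  · simp [padArray, hr, show ¬ t + e + 2 + i + 1 = b by omega, show ¬ t + e + 2 + i = b by omega,
      show t + e + 2 - (t + 1) = e + 1 by omega, show t + e + 2 - t = e + 2 by omega,
      zeroColumnSecond, show ¬ t + e + 2 < t + 1 by omega, show ¬ t + e + 2 < t by omega]

theorem padArray_transpose (δ : ℕ → ℕ → Matrix (Fin k) (Fin l) R) (s t : ℕ)
    (X : ℕ → ℕ → Matrix (Fin k) (Fin l) R) (r c : ℕ) :
    (padArray δ s t X c r).transpose =
      padArray (fun r c => (δ c r).transpose) t s (fun r c => (X c r).transpose) r c := by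
  simp only [padArray, or_comm (a := c < s)]
  split_ifs <;> rfl

theorem zeroRowSecond_transpose (X : ℕ → ℕ → Matrix (Fin k) (Fin l) R) :
    (fun r c => (zeroRowSecond X c r).transpose) =
      zeroColumnSecond fun r c => (X c r).transpose := by
  funext r c
  match c with
  | 0 | 1 | _ + 2 => simp [zeroRowSecond, zeroColumnSecond]

theorem fiedlerMid_mul_zero_pad {a b i s t : ℕ} (X : ℕ → ℕ → Matrix (Fin k) (Fin l) R)
    (P : ℕ → Matrix (Fin k) (Fin k) R) (hi : 1 ≤ i) (ha : s + 1 + i = a) :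
    fiedlerMid a P i * blockArray a b (padArray 0 (s + 1) t X) =
      blockArray a b (padArray 0 s t (zeroRowSecond X)) := by
  apply Matrix.transpose_injective
  have h := zero_pad_mul_fiedlerMid (a := b) (s := t) (fun r c => (X c r).transpose)
    (fun j => (P j).transpose) hi ha
  rw [Matrix.transpose_mul, fiedlerMid_transpose, blockArray_transpose, blockArray_transpose]
  simp only [padArray_transpose, zeroRowSecond_transpose]
  simpa [Pi.zero_def] using h

theorem zero_pad_row {s t : ℕ} (X : ℕ → ℕ → Matrix (Fin k) (Fin l) R) :
    padArray 0 (s + 1) t X = padArray 0 s t (zeroRowOnTop X) := by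
  funext r c
  by_cases hc : c < t
  · simp [padArray, hc]
  obtain h | rfl | ⟨e, rfl⟩ : r < s ∨ r = s ∨ ∃ e, r = s + e + 1 := by
    by_cases h : r < s + 1
    · omega
    · exact .inr (.inr ⟨r - s - 1, by omega⟩)
  · simp [padArray, h, show r < s + 1 by omega]
  · simp [padArray, zeroRowOnTop]
  · simp [padArray, hc, show s + e + 1 - (s + 1) = e by omega,
      show s + e + 1 - s = e + 1 by omega, show ¬ s + e + 1 < s by omega, zeroRowOnTop]

theorem zero_pad_column {s t : ℕ} (X : ℕ → ℕ → Matrix (Fin k) (Fin l) R) :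
    padArray 0 s (t + 1) X = padArray 0 s t (zeroColumnOnLeft X) := by
  funext r c
  by_cases hr : r < s
  · simp [padArray, hr]
  obtain h | rfl | ⟨e, rfl⟩ : c < t ∨ c = t ∨ ∃ e, c = t + e + 1 := by
    by_cases h : c < t + 1
    · omega
    · exact .inr (.inr ⟨c - t - 1, by omega⟩)
  · simp [padArray, h, show c < t + 1 by omega]
  · simp [padArray, zeroColumnOnLeft]
  · simp [padArray, hr, show t + e + 1 - (t + 1) = e by omega,
      show t + e + 1 - t = e + 1 by omega, show ¬ t + e + 1 < t by omega, zeroColumnOnLeft]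

theorem consecutionBorder_zero (X : ℕ → ℕ → Matrix (Fin k) (Fin l) R) :
    consecutionBorder 0 0 X = zeroColumnSecond (zeroRowOnTop X) := by
  funext r c
  match r, c with
  | 0, 0 | 0, 1 | 0, _ + 2 | _ + 1, 0 | _ + 1, 1 | _ + 1, _ + 2 => rfl

theorem inversionBorder_zero (X : ℕ → ℕ → Matrix (Fin k) (Fin l) R) :
    inversionBorder 0 0 X = zeroRowSecond (zeroColumnOnLeft X) := by
  funext r c
  match r, c with
  | 0, 0 | 0, _ + 1 | 1, 0 | 1, _ + 1 | _ + 2, 0 | _ + 2, _ + 1 => rfl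

theorem identity_pad_mul_fiedlerMid {b i s : ℕ} (X : ℕ → ℕ → Matrix (Fin k) (Fin k) R)
    (P : ℕ → Matrix (Fin k) (Fin k) R) (hi : 1 ≤ i) (hb : s + 1 + i = b) :
    blockArray b b (padArray identityArray (s + 1) (s + 1) X) * fiedlerMid b P i =
      blockArray b b (padArray identityArray s s (consecutionBorder (-P i) 1 X)) := by
  rw [blockArray_mul_fiedlerMid _ _ hi (by omega)]
  refine blockArray_congr fun r c _ _ => ?_
  obtain hc | rfl | rfl | ⟨e, rfl⟩ : c < s ∨ s = c ∨ c = s + 1 ∨ ∃ e, c = s + e + 2 := by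
    by_cases h : c < s + 2
    · omega
    · exact .inr (.inr (.inr ⟨c - s - 2, by omega⟩))
  · simp [padArray, hc, show ¬ c + i + 1 = b by omega, show ¬ c + i = b by omega,
      show c < s + 1 by omega]
  all_goals
    obtain h | rfl | ⟨e', rfl⟩ : r < s ∨ s = r ∨ ∃ e, r = s + e + 1 := by
      by_cases h : r < s + 1
      · omega
      · exact .inr (.inr ⟨r - s - 1, by omega⟩)
  · simp [padArray, identityArray, h, show s + i + 1 = b by omega, show r < s + 1 by omega,
      show r ≠ s by omega, show r ≠ s + 1 by omega]
  · simp [padArray, identityArray, show s + i + 1 = b by omega, consecutionBorder]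
  · simp [padArray, identityArray, show s + i + 1 = b by omega, consecutionBorder,
      show s + e' + 1 - (s + 1) = e' by omega, show s + e' + 1 - s = e' + 1 by omega,
      show ¬ s + e' + 1 < s by omega, show s + e' + 1 ≠ s by omega]
  · simp [padArray, identityArray, h, hb,
      show r < s + 1 by omega, show r ≠ s by omega, show r ≠ s + 1 by omega]
  · simp [padArray, identityArray, hb, consecutionBorder]
  · simp [padArray, identityArray, hb, consecutionBorder,
      show s + e' + 1 - s = e' + 1 by omega,
      show ¬ s + e' + 1 < s by omega, show s + e' + 1 ≠ s by omega]
  · simp [padArray, identityArray, h, show ¬ s + e + 2 + i + 1 = b by omega,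
      show ¬ s + e + 2 + i = b by omega, show r < s + 1 by omega]
  · simp [padArray, identityArray, show ¬ s + e + 2 + i + 1 = b by omega,
      show ¬ s + e + 2 + i = b by omega, show s + e + 2 - s = e + 2 by omega,
      show ¬ s + e + 2 < s by omega, show s ≠ s + e + 2 by omega, consecutionBorder]
  · simp [padArray, show ¬ s + e + 2 + i + 1 = b by omega,
      show ¬ s + e + 2 + i = b by omega, show s + e + 2 - s = e + 2 by omega,
      show s + e + 2 - (s + 1) = e + 1 by omega,
      show ¬ s + e + 2 < s by omega, show ¬ s + e + 2 < s + 1 by omega, consecutionBorder,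
      show s + e' + 1 - s = e' + 1 by omega, show ¬ s + e' + 1 < s by omega,
      show s + e' + 1 - (s + 1) = e' by omega]

theorem inversionBorder_transpose (x y : Matrix (Fin k) (Fin l) R)
    (X : ℕ → ℕ → Matrix (Fin k) (Fin l) R) :
    (fun r c => (inversionBorder x y X c r).transpose) =
      consecutionBorder x.transpose y.transpose fun r c => (X c r).transpose := by
  funext r c
  match r, c with
  | 0, 0 | 0, 1 | 0, _ + 2 | _ + 1, 0 | _ + 1, 1 | _ + 1, _ + 2 =>
    simp [inversionBorder, consecutionBorder]

theorem identityArray_transpose :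
    (fun r c => (identityArray c r : Matrix (Fin k) (Fin k) R).transpose) = identityArray := by
  funext r c
  simp only [identityArray, eq_comm (a := c)]
  split_ifs <;> simp

theorem fiedlerMid_mul_identity_pad {b i s : ℕ} (X : ℕ → ℕ → Matrix (Fin k) (Fin k) R)
    (P : ℕ → Matrix (Fin k) (Fin k) R) (hi : 1 ≤ i) (hb : s + 1 + i = b) :
    fiedlerMid b P i * blockArray b b (padArray identityArray (s + 1) (s + 1) X) =
      blockArray b b (padArray identityArray s s (inversionBorder (-P i) 1 X)) := by
  apply Matrix.transpose_injective
  have h := identity_pad_mul_fiedlerMid (fun r c => (X c r).transpose)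
    (fun j => (P j).transpose) hi hb
  rw [Matrix.transpose_mul, fiedlerMid_transpose, blockArray_transpose, blockArray_transpose]
  simp only [padArray_transpose, identityArray_transpose, inversionBorder_transpose]
  simpa using h

end Blocks

section System

variable {R : Type*} [CommRing R] {n m : ℕ}

namespace SysBlockMatrix

/-- The `dA + dD` block matrix in which `W` occupies the last block positions of both parts and
which agrees with the identity elsewhere. -/
def pad (dA dD : ℕ) (W : SysBlockMatrix R n m) : SysMatrix R n m dA dD :=
  Matrix.fromBlocks
    (blockArray dA dA (padArray identityArray (dA - W.p) (dA - W.p) W.aa))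
    (blockArray dA dD (padArray 0 (dA - W.p) (dD - W.q) W.ad))
    (blockArray dD dA (padArray 0 (dD - W.q) (dA - W.p) W.da))
    (blockArray dD dD (padArray identityArray (dD - W.q) (dD - W.q) W.dd))

theorem pad_self (W : SysBlockMatrix R n m) : W.pad W.p W.q = W.mat := by
  ext (⟨r, x⟩ | ⟨r, x⟩) (⟨c, y⟩ | ⟨c, y⟩) <;>
    simp [pad, blockArray, padArray, aa, ad, da, dd]

theorem eq_mk_pad {dA dD : ℕ} (W : SysBlockMatrix R n m) (hp : W.p = dA) (hq : W.q = dD) :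
    W = ⟨dA, dD, W.pad dA dD⟩ := by
  subst hp hq
  rw [pad_self]

section OfBlocks

variable {p q : ℕ}
  {AA : ℕ → ℕ → Matrix (Fin n) (Fin n) R} {AD : ℕ → ℕ → Matrix (Fin n) (Fin m) R}
  {DA : ℕ → ℕ → Matrix (Fin m) (Fin n) R} {DD : ℕ → ℕ → Matrix (Fin m) (Fin m) R}

theorem ofBlocks_aa (r c : ℕ) : (ofBlocks p q AA AD DA DD).aa r c =
    if r < p ∧ c < p then AA r c else 0 :=
  rfl

theorem ofBlocks_ad (r c : ℕ) : (ofBlocks p q AA AD DA DD).ad r c =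
    if r < p ∧ c < q then AD r c else 0 :=
  rfl

theorem ofBlocks_da (r c : ℕ) : (ofBlocks p q AA AD DA DD).da r c =
    if r < q ∧ c < p then DA r c else 0 :=
  rfl

theorem ofBlocks_dd (r c : ℕ) : (ofBlocks p q AA AD DA DD).dd r c =
    if r < q ∧ c < q then DD r c else 0 :=
  rfl

theorem pad_ofBlocks {dA dD : ℕ} (hp : p ≤ dA) (hq : q ≤ dD) :
    (ofBlocks p q AA AD DA DD).pad dA dD = Matrix.fromBlocks
      (blockArray dA dA (padArray identityArray (dA - p) (dA - p) AA))
      (blockArray dA dD (padArray 0 (dA - p) (dD - q) AD))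
      (blockArray dD dA (padArray 0 (dD - q) (dA - p) DA))
      (blockArray dD dD (padArray identityArray (dD - q) (dD - q) DD)) := by
  have hp' : (ofBlocks p q AA AD DA DD).p = p := rfl
  have hq' : (ofBlocks p q AA AD DA DD).q = q := rfl
  rw [pad, hp', hq']
  congr 1 <;> refine blockArray_congr fun r c hr hc => ?_ <;>
    simp only [padArray, ofBlocks_aa, ofBlocks_ad, ofBlocks_da, ofBlocks_dd] <;>
    split_ifs <;> first | rfl | (exfalso; omega)

end OfBlocks

end SysBlockMatrix

open SysBlockMatrix

theorem pad_algorithmFirstLoop {d dA dD i : ℕ}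
    (A : ℕ → Matrix (Fin n) (Fin n) R) (B : Matrix (Fin n) (Fin m) R)
    (C : Matrix (Fin m) (Fin n) R) (D : ℕ → Matrix (Fin m) (Fin m) R)
    (σ : Fin d ≃ Set.Icc 1 d) (W : SysBlockMatrix R n m) (hp : W.p = i + 1) (hq : W.q = i + 1)
    (hA : i + 1 < dA) (hD : i + 1 < dD) :
    (algorithmFirstLoop A D σ i W).pad dA dD =
      if HasConsecutionAt σ i then W.pad dA dD * sysFiedler dA dD A B C D (i + 1)
      else sysFiedler dA dD A B C D (i + 1) * W.pad dA dD := by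
  have hs : sysFiedler dA dD A B C D (i + 1) =
      Matrix.fromBlocks (fiedlerMid dA A (i + 1)) 0 0 (fiedlerMid dD D (i + 1)) := by
    rw [sysFiedler, if_neg (by omega), if_neg (by omega), if_pos hA, if_pos hD]
  obtain ⟨s, rfl⟩ : ∃ s, dA = s + 1 + (i + 1) := ⟨dA - (i + 2), by omega⟩
  obtain ⟨t, rfl⟩ : ∃ t, dD = t + 1 + (i + 1) := ⟨dD - (i + 2), by omega⟩
  have e₁ (s : ℕ) : s + 1 + (i + 1) - (i + 1) = s + 1 := by omega
  have e₂ (s : ℕ) : s + 1 + (i + 1) - (i + 1 + 1) = s := by omega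
  rw [algorithmFirstLoop, hs]
  split_ifs
  · rw [pad_ofBlocks (by omega) (by omega), pad, hp, hq, Matrix.fromBlocks_multiply]
    simp only [Matrix.mul_zero, add_zero, zero_add, e₁, e₂,
      identity_pad_mul_fiedlerMid _ _ (Nat.le_add_left 1 i) rfl,
      zero_pad_mul_fiedlerMid _ _ (Nat.le_add_left 1 i) rfl, zero_pad_row, consecutionBorder_zero]
  · rw [pad_ofBlocks (by omega) (by omega), pad, hp, hq, Matrix.fromBlocks_multiply]
    simp only [Matrix.zero_mul, add_zero, zero_add, e₁, e₂,
      fiedlerMid_mul_identity_pad _ _ (Nat.le_add_left 1 i) rfl,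
      fiedlerMid_mul_zero_pad _ _ (Nat.le_add_left 1 i) rfl, zero_pad_column, inversionBorder_zero]

theorem pad_algorithmSecondLoop {d dA dD i : ℕ}
    (A : ℕ → Matrix (Fin n) (Fin n) R) (B : Matrix (Fin n) (Fin m) R)
    (C : Matrix (Fin m) (Fin n) R) (D : ℕ → Matrix (Fin m) (Fin m) R)
    (σ : Fin d ≃ Set.Icc 1 d) (W : SysBlockMatrix R n m) (hp : W.p = i + 1) (hq : W.q = dD)
    (hA : i + 1 < dA) (hD : dD ≤ i + 1) :
    (algorithmSecondLoop A σ i W).pad dA dD =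
      if HasConsecutionAt σ i then W.pad dA dD * sysFiedler dA dD A B C D (i + 1)
      else sysFiedler dA dD A B C D (i + 1) * W.pad dA dD := by
  have hs : sysFiedler dA dD A B C D (i + 1) =
      Matrix.fromBlocks (fiedlerMid dA A (i + 1)) 0 0 1 := by
    rw [sysFiedler, if_neg (by omega), if_neg (by omega), if_pos hA, if_neg (by omega)]
  obtain ⟨s, rfl⟩ : ∃ s, dA = s + 1 + (i + 1) := ⟨dA - (i + 2), by omega⟩
  have e₁ (s : ℕ) : s + 1 + (i + 1) - (i + 1) = s + 1 := by omega
  have e₂ (s : ℕ) : s + 1 + (i + 1) - (i + 1 + 1) = s := by omega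
  rw [algorithmSecondLoop, hs]
  split_ifs
  · rw [pad_ofBlocks (by omega) (by omega), pad, hp, hq, Matrix.fromBlocks_multiply]
    simp only [Matrix.mul_zero, Matrix.mul_one, add_zero, zero_add, e₁, e₂,
      identity_pad_mul_fiedlerMid _ _ (Nat.le_add_left 1 i) rfl,
      zero_pad_mul_fiedlerMid _ _ (Nat.le_add_left 1 i) rfl, zero_pad_row]
  · rw [pad_ofBlocks (by omega) (by omega), pad, hp, hq, Matrix.fromBlocks_multiply]
    simp only [Matrix.zero_mul, Matrix.one_mul, add_zero, zero_add, e₁, e₂,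
      fiedlerMid_mul_identity_pad _ _ (Nat.le_add_left 1 i) rfl,
      fiedlerMid_mul_zero_pad _ _ (Nat.le_add_left 1 i) rfl, zero_pad_column]

/-- The block matrix `[-A₀, B; -C, -D₀]`. -/
def constantCore (A : ℕ → Matrix (Fin n) (Fin n) R) (B : Matrix (Fin n) (Fin m) R)
    (C : Matrix (Fin m) (Fin n) R) (D : ℕ → Matrix (Fin m) (Fin m) R) : SysBlockMatrix R n m :=
  ofBlocks 1 1 (fun _ _ => -A 0) (fun _ _ => B) (fun _ _ => -C) (fun _ _ => -D 0)

theorem fiedlerFirst_eq_blockArray {k b : ℕ} (hb : 1 ≤ b) (P : ℕ → Matrix (Fin k) (Fin k) R) :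
    fiedlerFirst b P =
      blockArray b b (padArray identityArray (b - 1) (b - 1) fun _ _ => -P 0) := by
  ext ⟨r, x⟩ ⟨c, y⟩
  simp only [fiedlerFirst, blockArray, Matrix.comp_apply, Matrix.of_apply, padArray,
    identityArray, Matrix.diagonal_apply, Fin.ext_iff]
  split_ifs <;> first | rfl | (exfalso; omega)

theorem unitColumn_kronecker {k l a b : ℕ} (X : Matrix (Fin k) (Fin l) R) :
    Matrix.vecMulVec (unitColumn R a a) (unitColumn R b b) ⊗ₖ X =
      blockArray a b (padArray 0 (a - 1) (b - 1) fun _ _ => X) := by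
  ext ⟨r, x⟩ ⟨c, y⟩
  simp only [blockArray, Matrix.comp_apply, Matrix.of_apply, padArray, Matrix.kroneckerMap_apply,
    Matrix.vecMulVec_apply, unitColumn]
  split_ifs <;> first | (exfalso; omega) | simp

theorem pad_constantCore {dA dD : ℕ} (hA : 1 ≤ dA) (hD : 1 ≤ dD)
    (A : ℕ → Matrix (Fin n) (Fin n) R) (B : Matrix (Fin n) (Fin m) R)
    (C : Matrix (Fin m) (Fin n) R) (D : ℕ → Matrix (Fin m) (Fin m) R) :
    (constantCore A B C D).pad dA dD = sysFiedler dA dD A B C D 0 := by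
  rw [constantCore, pad_ofBlocks hA hD, sysFiedler, if_pos rfl, fiedlerFirst_eq_blockArray hA,
    fiedlerFirst_eq_blockArray hD, unitColumn_kronecker, ← unitColumn_kronecker (-C)]
  congr 1
  ext
  simp

theorem algorithmInit_eq_firstLoop {d : ℕ}
    (A : ℕ → Matrix (Fin n) (Fin n) R) (B : Matrix (Fin n) (Fin m) R)
    (C : Matrix (Fin m) (Fin n) R) (D : ℕ → Matrix (Fin m) (Fin m) R)
    (σ : Fin d ≃ Set.Icc 1 d) :
    algorithmInit A B C D σ = algorithmFirstLoop A D σ 0 (constantCore A B C D) := by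
  rw [algorithmInit, algorithmFirstLoop]
  split_ifs <;> rw [ofBlocks] <;> congr 1 <;> congr 1 <;>
    ext ⟨r, x⟩ ⟨c, y⟩ <;> fin_cases r <;> fin_cases c <;> rfl

section Sequence

variable {d : ℕ} (dD : ℕ) (A : ℕ → Matrix (Fin n) (Fin n) R) (B : Matrix (Fin n) (Fin m) R)
  (C : Matrix (Fin m) (Fin n) R) (D : ℕ → Matrix (Fin m) (Fin m) R) (σ : Fin d ≃ Set.Icc 1 d)

theorem algorithmW_p (i : ℕ) : (algorithmW dD A B C D σ i).p = i + 2 := by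
  induction i with
  | zero => rw [algorithmW, algorithmInit]; split_ifs <;> rfl
  | succ i ih =>
    rw [algorithmW, algorithmFirstLoop, algorithmSecondLoop]
    split_ifs <;> simp only [ofBlocks, ih]

theorem algorithmW_q (hD : 2 ≤ dD) (i : ℕ) :
    (algorithmW dD A B C D σ i).q = min (i + 2) dD := by
  induction i with
  | zero => rw [algorithmW, algorithmInit]; split_ifs <;> simp [hD]
  | succ i ih =>
    rw [algorithmW, algorithmFirstLoop, algorithmSecondLoop]
    split_ifs <;> simp only [ofBlocks, ih] <;> omega

theorem pad_algorithmW {dA : ℕ} (hD : 2 ≤ dD) (i : ℕ) (hA : i + 1 < dA) :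
    (algorithmW dD A B C D σ i).pad dA dD =
      borderedProduct (sysFiedler dA dD A B C D) (HasConsecutionAt σ) (i + 1) := by
  induction i with
  | zero =>
    rw [algorithmW, algorithmInit_eq_firstLoop,
      pad_algorithmFirstLoop A B C D σ _ rfl rfl hA (by omega),
      pad_constantCore (by omega) (by omega)]
    rfl
  | succ i ih =>
    have hp := algorithmW_p dD A B C D σ i
    have hq := algorithmW_q dD A B C D σ hD i
    rw [algorithmW, borderedProduct, ← ih (by omega)]
    split_ifs with h₁ h₂ h₂
    · rw [pad_algorithmFirstLoop A B C D σ _ hp (by omega) hA (by omega), if_pos h₂]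
    · rw [pad_algorithmFirstLoop A B C D σ _ hp (by omega) hA (by omega), if_neg h₂]
    · rw [pad_algorithmSecondLoop A B C D σ _ hp (by omega) hA (by omega), if_pos h₂]
    · rw [pad_algorithmSecondLoop A B C D σ _ hp (by omega) hA (by omega), if_neg h₂]

end Sequence

theorem blockArray_identity_pad_commute {k b i s : ℕ} (X : ℕ → ℕ → Matrix (Fin k) (Fin k) R)
    (P : ℕ → Matrix (Fin k) (Fin k) R) (hi : 1 ≤ i) (hb : i < b) (hs : b + 1 ≤ s + i) :
    Commute (blockArray b b (padArray identityArray s s X)) (fiedlerMid b P i) :=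
  blockArray_commute_fiedlerMid P hi hb fun r c h => by
    rw [padArray, if_pos (by omega)]

theorem zero_pad_mul_fiedlerMid_eq_self {k l a b i s t : ℕ}
    (X : ℕ → ℕ → Matrix (Fin k) (Fin l) R)
    (P : ℕ → Matrix (Fin l) (Fin l) R) (hi : 1 ≤ i) (hb : i < b) (ht : b + 1 ≤ t + i) :
    blockArray a b (padArray 0 s t X) * fiedlerMid b P i = blockArray a b (padArray 0 s t X) := by
  rw [blockArray_mul_fiedlerMid _ _ hi hb]
  refine blockArray_congr fun r c _ _ => ?_
  simp only [padArray]
  split_ifs <;> first | (exfalso; omega) | simp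

theorem fiedlerMid_mul_zero_pad_eq_self {k l a b i s t : ℕ}
    (X : ℕ → ℕ → Matrix (Fin k) (Fin l) R)
    (P : ℕ → Matrix (Fin k) (Fin k) R) (hi : 1 ≤ i) (ha : i < a) (hs : a + 1 ≤ s + i) :
    fiedlerMid a P i * blockArray a b (padArray 0 s t X) = blockArray a b (padArray 0 s t X) := by
  rw [fiedlerMid_mul_blockArray _ _ hi ha]
  refine blockArray_congr fun r c _ _ => ?_
  simp only [padArray]
  split_ifs <;> first | (exfalso; omega) | simp

theorem sysFiedler_commute {dA dD : ℕ} (hD : 1 ≤ dD) (hAD : dD ≤ dA)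
    (A : ℕ → Matrix (Fin n) (Fin n) R) (B : Matrix (Fin n) (Fin m) R)
    (C : Matrix (Fin m) (Fin n) R) (D : ℕ → Matrix (Fin m) (Fin m) R) {i j : ℕ}
    (hij : i + 2 ≤ j) (hj : j < dA) :
    Commute (sysFiedler dA dD A B C D i) (sysFiedler dA dD A B C D j) := by
  have hsj : sysFiedler dA dD A B C D j = Matrix.fromBlocks (fiedlerMid dA A j) 0 0
      (if j < dD then fiedlerMid dD D j else 1) := by
    rw [sysFiedler, if_neg (by omega), if_neg (by omega), if_pos hj]
  rw [Commute, SemiconjBy, hsj]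
  obtain rfl | hi := Nat.eq_zero_or_pos i
  · have hA₁ : 1 ≤ dA := by omega
    rw [← pad_constantCore hA₁ hD, constantCore, pad_ofBlocks hA₁ hD,
      Matrix.fromBlocks_multiply, Matrix.fromBlocks_multiply]
    simp only [Matrix.zero_mul, Matrix.mul_zero, add_zero, zero_add]
    congr 1
    · exact blockArray_identity_pad_commute _ _ (by omega) hj (by omega)
    · rw [fiedlerMid_mul_zero_pad_eq_self _ _ (by omega) hj (by omega)]
      split_ifs with h
      · exact zero_pad_mul_fiedlerMid_eq_self _ _ (by omega) h (by omega)
      · exact Matrix.mul_one _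
    · rw [zero_pad_mul_fiedlerMid_eq_self _ _ (by omega) hj (by omega)]
      split_ifs with h
      · exact (fiedlerMid_mul_zero_pad_eq_self _ _ (by omega) h (by omega)).symm
      · exact (Matrix.one_mul _).symm
    · split_ifs with h
      · exact blockArray_identity_pad_commute _ _ (by omega) h (by omega)
      · rw [Matrix.one_mul, Matrix.mul_one]
  · rw [sysFiedler, if_neg (by omega), if_neg (by omega), if_pos (by omega),
      Matrix.fromBlocks_multiply, Matrix.fromBlocks_multiply]
    simp only [Matrix.zero_mul, Matrix.mul_zero, add_zero, zero_add]
    congr 1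
    · exact fiedlerMid_commute_fiedlerMid A hij hj
    · split_ifs with h₁ h₂ h₂
      · exact fiedlerMid_commute_fiedlerMid D hij h₂
      all_goals simp

theorem sysFiedlerProduct_eq_borderedProduct {d dD : ℕ} (hD : 1 ≤ dD) (hAD : dD ≤ d + 1)
    (A : ℕ → Matrix (Fin n) (Fin n) R) (B : Matrix (Fin n) (Fin m) R)
    (C : Matrix (Fin m) (Fin n) R) (D : ℕ → Matrix (Fin m) (Fin m) R)
    (σ : Fin (d + 1) ≃ Set.Icc 1 (d + 1)) :
    sysFiedlerProduct (d + 1) dD A B C D σ =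
      borderedProduct (sysFiedler (d + 1) dD A B C D) (HasConsecutionAt σ) d := by
  have h := List.prod_map_eq_borderedProduct (sysFiedler (d + 1) dD A B C D)
    (fun i => if h : i < d + 1 then (σ ⟨i, h⟩ : ℕ) else 0) (HasConsecutionAt σ) d
    (fun i j hij hj => sysFiedler_commute hD hAD A B C D hij (by omega))
    (fun i hi => by
      have h₁ : i < d + 1 := by omega
      have h₂ : i + 1 < d + 1 := by omega
      simp [HasConsecutionAt, h₁, hi])
    (List.ofFn fun j : Fin (d + 1) =>
      ((σ.symm ⟨(j : ℕ) + 1, Nat.succ_le_succ (Nat.zero_le _), j.isLt⟩ : Fin (d + 1)) : ℕ))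
    (fun x => by
      rw [List.mem_ofFn]
      constructor
      · rintro ⟨j, rfl⟩
        exact Nat.le_of_lt_succ (Fin.isLt _)
      · intro hx
        have h₁ := (σ ⟨x, by omega⟩).2.1
        have h₂ := (σ ⟨x, by omega⟩).2.2
        refine ⟨⟨(σ ⟨x, by omega⟩ : ℕ) - 1, by omega⟩, ?_⟩
        simp [Nat.sub_add_cancel h₁])
    (by
      rw [List.pairwise_ofFn]
      intro a b hab
      simp only [Fin.is_lt, dite_true, Fin.eta, Equiv.apply_symm_apply]
      simpa using hab)
  rw [← h, sysFiedlerProduct, List.map_ofFn]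
  rfl

namespace SysBlockMatrix

theorem consecutionBorder_succ {k l : ℕ} (x y : Matrix (Fin k) (Fin l) R)
    (X : ℕ → ℕ → Matrix (Fin k) (Fin l) R) (r c : ℕ) :
    consecutionBorder x y X (r + 1) (if c < 1 then c else c + 1) = X r c := by
  match c with
  | 0 | _ + 1 => simp [consecutionBorder]

theorem inversionBorder_succ {k l : ℕ} (x y : Matrix (Fin k) (Fin l) R)
    (X : ℕ → ℕ → Matrix (Fin k) (Fin l) R) (r c : ℕ) :
    inversionBorder x y X (if r < 1 then r else r + 1) (c + 1) = X r c := by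
  match r with
  | 0 | _ + 1 => simp [inversionBorder]

theorem zeroColumnSecond_succ {k l : ℕ} (X : ℕ → ℕ → Matrix (Fin k) (Fin l) R) (r c : ℕ) :
    zeroColumnSecond X r (if c < 1 then c else c + 1) = X r c := by
  match c with
  | 0 | _ + 1 => simp [zeroColumnSecond]

theorem zeroRowSecond_succ {k l : ℕ} (X : ℕ → ℕ → Matrix (Fin k) (Fin l) R) (r c : ℕ) :
    zeroRowSecond X (if r < 1 then r else r + 1) c = X r c := by
  match r with
  | 0 | _ + 1 => simp [zeroRowSecond]

/-- `W` is a block submatrix of every block matrix that has its blocks in selected positions. -/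
theorem isBlockSubmatrix_ofBlocks (W : SysBlockMatrix R n m) {p q : ℕ}
    {AA : ℕ → ℕ → Matrix (Fin n) (Fin n) R} {AD : ℕ → ℕ → Matrix (Fin n) (Fin m) R}
    {DA : ℕ → ℕ → Matrix (Fin m) (Fin n) R} {DD : ℕ → ℕ → Matrix (Fin m) (Fin m) R}
    (rA cA : Fin W.p ↪o Fin p) (rD cD : Fin W.q ↪o Fin q)
    (hAA : ∀ r c, AA (rA r) (cA c) = W.aa r c) (hAD : ∀ r c, AD (rA r) (cD c) = W.ad r c)
    (hDA : ∀ r c, DA (rD r) (cA c) = W.da r c) (hDD : ∀ r c, DD (rD r) (cD c) = W.dd r c) :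
    W.IsBlockSubmatrix (ofBlocks p q AA AD DA DD) := by
  refine ⟨rA, cA, rD, cD, ?_⟩
  ext (⟨r, x⟩ | ⟨r, x⟩) (⟨c, y⟩ | ⟨c, y⟩)
  · have h := congr_fun₂ (hAA r c) x y
    rw [aa, dif_pos ⟨r.2, c.2⟩] at h
    exact h.symm
  · have h := congr_fun₂ (hAD r c) x y
    rw [ad, dif_pos ⟨r.2, c.2⟩] at h
    exact h.symm
  · have h := congr_fun₂ (hDA r c) x y
    rw [da, dif_pos ⟨r.2, c.2⟩] at h
    exact h.symm
  · have h := congr_fun₂ (hDD r c) x y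
    rw [dd, dif_pos ⟨r.2, c.2⟩] at h
    exact h.symm

end SysBlockMatrix

theorem val_succAboveOrderEmb_one {p : ℕ} (h : 1 < p + 1) (c : Fin p) :
    ((Fin.succAboveOrderEmb ⟨1, h⟩ c : Fin (p + 1)) : ℕ) =
      if (c : ℕ) < 1 then (c : ℕ) else (c : ℕ) + 1 := by
  simp only [Fin.succAboveOrderEmb_apply, Fin.succAbove, Fin.lt_def, Fin.val_castSucc]
  split_ifs <;> simp

theorem isBlockSubmatrix_algorithmFirstLoop {d : ℕ}
    (A : ℕ → Matrix (Fin n) (Fin n) R) (D : ℕ → Matrix (Fin m) (Fin m) R)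
    (σ : Fin d ≃ Set.Icc 1 d) (i : ℕ) (W : SysBlockMatrix R n m) (hp : 0 < W.p) (hq : 0 < W.q) :
    W.IsBlockSubmatrix (algorithmFirstLoop A D σ i W) := by
  have hp' : 1 < W.p + 1 := by omega
  have hq' : 1 < W.q + 1 := by omega
  rw [algorithmFirstLoop]
  split_ifs
  · apply isBlockSubmatrix_ofBlocks W (Fin.succOrderEmb _) (Fin.succAboveOrderEmb ⟨1, hp'⟩)
      (Fin.succOrderEmb _) (Fin.succAboveOrderEmb ⟨1, hq'⟩) <;> intro r c <;>
      rw [val_succAboveOrderEmb_one, Fin.coe_succOrderEmb, Fin.val_succ, consecutionBorder_succ]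
  · apply isBlockSubmatrix_ofBlocks W (Fin.succAboveOrderEmb ⟨1, hp'⟩) (Fin.succOrderEmb _)
      (Fin.succAboveOrderEmb ⟨1, hq'⟩) (Fin.succOrderEmb _) <;> intro r c <;>
      rw [val_succAboveOrderEmb_one, Fin.coe_succOrderEmb, Fin.val_succ, inversionBorder_succ]

theorem isBlockSubmatrix_algorithmSecondLoop {d : ℕ} (A : ℕ → Matrix (Fin n) (Fin n) R)
    (σ : Fin d ≃ Set.Icc 1 d) (i : ℕ) (W : SysBlockMatrix R n m) (hp : 0 < W.p) :
    W.IsBlockSubmatrix (algorithmSecondLoop A σ i W) := by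
  have hp' : 1 < W.p + 1 := by omega
  rw [algorithmSecondLoop]
  split_ifs
  · refine isBlockSubmatrix_ofBlocks W (Fin.succOrderEmb _) (Fin.succAboveOrderEmb ⟨1, hp'⟩)
      (RelEmbedding.refl _) (RelEmbedding.refl _) (fun r c => ?_) (fun r c => rfl)
      (fun r c => ?_) (fun r c => rfl)
    · rw [val_succAboveOrderEmb_one, Fin.coe_succOrderEmb, Fin.val_succ, consecutionBorder_succ]
    · rw [val_succAboveOrderEmb_one, zeroColumnSecond_succ]
      rfl
  · refine isBlockSubmatrix_ofBlocks W (Fin.succAboveOrderEmb ⟨1, hp'⟩) (Fin.succOrderEmb _)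
      (RelEmbedding.refl _) (RelEmbedding.refl _) (fun r c => ?_) (fun r c => ?_)
      (fun r c => rfl) (fun r c => rfl)
    · rw [val_succAboveOrderEmb_one, Fin.coe_succOrderEmb, Fin.val_succ, inversionBorder_succ]
    · rw [val_succAboveOrderEmb_one, zeroRowSecond_succ]
      rfl

end System

theorem mainTheorem4 (n m dA dD : ℕ) (hD2 : 2 ≤ dD) (hAD : dD < dA)
    (A : Polynomial (Matrix (Fin n) (Fin n) ℂ)) (hA : A.natDegree ≤ dA)
    (D : Polynomial (Matrix (Fin m) (Fin m) ℂ)) (hD : D.natDegree ≤ dD)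
    (B : Matrix (Fin n) (Fin m) ℂ) (C : Matrix (Fin m) (Fin n) ℂ)
    (σ : Fin dA ≃ Set.Icc 1 dA) :
    (∀ i, i ≤ dA - 2 →
      (algorithmW dD A.coeff B C D.coeff σ i).p = i + 2 ∧
      (algorithmW dD A.coeff B C D.coeff σ i).q = min (i + 2) dD) ∧
    (∀ i, 1 ≤ i → i ≤ dA - 2 →
      (algorithmW dD A.coeff B C D.coeff σ (i - 1)).IsBlockSubmatrix
        (algorithmW dD A.coeff B C D.coeff σ i)) ∧
    algorithmW dD A.coeff B C D.coeff σ (dA - 2) =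
      ⟨dA, dD, sysFiedlerProduct dA dD A.coeff B C D.coeff σ⟩ := by
  have hp := algorithmW_p dD A.coeff B C D.coeff σ
  have hq := algorithmW_q dD A.coeff B C D.coeff σ hD2
  refine ⟨fun i _ => ⟨hp i, hq i⟩, fun i hi _ => ?_, ?_⟩
  · obtain ⟨i, rfl⟩ := Nat.exists_eq_add_of_le' hi
    have hpi := hp i
    have hqi := hq i
    rw [Nat.add_sub_cancel, algorithmW]
    split_ifs
    · exact isBlockSubmatrix_algorithmFirstLoop _ _ _ _ _ (by omega) (by omega)
    · exact isBlockSubmatrix_algorithmSecondLoop _ _ _ _ (by omega)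
  · obtain ⟨d, rfl⟩ : ∃ d, dA = d + 2 := ⟨dA - 2, by omega⟩
    have hqd := (hq d).trans (min_eq_right hAD.le)
    rw [Nat.add_sub_cancel, SysBlockMatrix.eq_mk_pad _ (hp d) hqd,
      pad_algorithmW dD A.coeff B C D.coeff σ hD2 d (by omega),
      sysFiedlerProduct_eq_borderedProduct (Nat.le_of_succ_le hD2) hAD.le]
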